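/- Let $n\ge 5$ and let $A=(A_i)_{i\in\mathbb Z/n\mathbb Z}$, $A_i=(x_i,y_i)\in\mathbb R^2$, be the vertices, in cyclic order, of a (strictly) convex $n$-gon; that is, for every $i$ all vertices other than $A_i,A_{i+1}$ lie strictly on one and the same side of the line $A_iA_{i+1}$. The pentagram map $T$ sends $A$ to the polygon $T(A)$ whose $i$-th vertex is the intersection point of the diagonals $A_{i-1}A_{i+1}$ and $A_iA_{i+2}$. Put $u_i=(x_i,y_i,1)^{T}\in\mathbb R^3$, and let $L_A$ be the real $3\times 3$ matrix of the linear map $$L_A(v)=nv-\sum_{j=1}^{n}\frac{|u_{j-1},v,u_{j+1}|}{|u_{j-1},u_j,u_{j+1}|}\,u_j ,$$ where $|\cdot,\cdot,\cdot|$ is the determinant of three vectors and indices are taken modulo $n$. Then the iterates $T^k(A)$ converge, as $k\to\infty$, to a single point $(X,Y)\in\mathbb R^2$ (that is, for each $i$ the $i$-th vertex of $T^k(A)$ tends to $(X,Y)$), and the vector $(X,Y,1)^{T}$ is an eigenvector of $L_A$ with some real eigenvalue $\lambda$ such that, with $K=\mathbb Q(x_1,y_1,\dots,x_n,y_n)$,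 the field extension $K(\lambda)/K$ has degree at most $3$ and contains both $X$ and $Y$. -/

import Mathlib

noncomputable section

namespace Pentagram

/-- The lift `(x, y, 1) ∈ ℝ³` of the point `(x, y)` of the plane. -/
def lift (p : ℝ × ℝ) : Fin 3 → ℝ := ![p.1, p.2, 1]

/-- The determinant `|a, b, c|` of three vectors of `ℝ³`. -/
def det3 (a b c : Fin 3 → ℝ) : ℝ := Matrix.det (Matrix.of ![a, b, c])

/-- `orient p q r` is twice the signed area of the triangle `p q r`: it is positive, negative or
zero according to whether `r` lies to the left of, to the right of, or on the line from `p` to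
`q`. -/
def orient (p q r : ℝ × ℝ) : ℝ := det3 (lift p) (lift q) (lift r)

/-- `A` is the list of vertices, in cyclic order (of either orientation), of a convex `n`-gon:
all vertices other than the two ends of a side lie strictly on one side of the line that carries
that side. For `n ≥ 3` the vertices are then distinct, no three of them are collinear, and the
sides `A i, A (i + 1)` are the edges of the convex hull. -/
def IsConvexPolygon {n : ℕ} (A : ZMod n → ℝ × ℝ) : Prop :=
  (∀ i j : ZMod n, j ≠ i → j ≠ i + 1 → 0 < orient (A i) (A (i + 1)) (A j)) ∨
  (∀ i j : ZMod n, j ≠ i → j ≠ i + 1 → orient (A i) (A (i + 1)) (A j) < 0)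

/-- The intersection point of the lines `p q` and `r s`, meaningful when these are not parallel;
see `line_inf_line_eq`. -/
def lineInter (p q r s : ℝ × ℝ) : ℝ × ℝ :=
  AffineMap.lineMap p q (orient r s p / (orient r s p - orient r s q))

/-- The pentagram map `T`: the `i`-th vertex of `T A` is the intersection of the diagonals
`A (i - 1) A (i + 1)` and `A i A (i + 2)`. -/
def pentagramMap {n : ℕ} (A : ZMod n → ℝ × ℝ) : ZMod n → ℝ × ℝ :=
  fun i => lineInter (A (i - 1)) (A (i + 1)) (A i) (A (i + 2))

theorem orient_eq (p q r : ℝ × ℝ) :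
    orient p q r = (q.1 - p.1) * (r.2 - p.2) - (q.2 - p.2) * (r.1 - p.1) := by
  simp [orient, det3, lift, Matrix.det_fin_three]
  ring

/-- Unless the lines `p q` and `r s` are parallel, `lineInter p q r s` is their only common
point. -/
theorem line_inf_line_eq {p q r s : ℝ × ℝ} (h : orient r s p ≠ orient r s q) :
    ((affineSpan ℝ {p, q} : AffineSubspace ℝ (ℝ × ℝ)) : Set (ℝ × ℝ)) ∩
      (affineSpan ℝ {r, s} : AffineSubspace ℝ (ℝ × ℝ)) = {lineInter p q r s} := by
  have h' : orient r s p - orient r s q ≠ 0 := sub_ne_zero.mpr h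
  have key : ∀ t : ℝ, orient r s (AffineMap.lineMap p q t) =
      orient r s p - t * (orient r s p - orient r s q) := by
    intro t
    simp only [orient_eq, AffineMap.lineMap_apply, vsub_eq_sub, vadd_eq_add, Prod.fst_add,
      Prod.snd_add, Prod.smul_fst, Prod.smul_snd, Prod.fst_sub, Prod.snd_sub, smul_eq_mul]
    ring
  have mem_zero : ∀ x : ℝ × ℝ, x ∈ (affineSpan ℝ {r, s} : AffineSubspace ℝ (ℝ × ℝ)) →
      orient r s x = 0 := by
    intro x hx
    obtain ⟨t, rfl⟩ := mem_affineSpan_pair_iff_exists_lineMap_eq.mp hx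
    simp only [orient_eq, AffineMap.lineMap_apply, vsub_eq_sub, vadd_eq_add, Prod.fst_add,
      Prod.snd_add, Prod.smul_fst, Prod.smul_snd, Prod.fst_sub, Prod.snd_sub, smul_eq_mul]
    ring
  have zero_mem : ∀ x : ℝ × ℝ, orient r s x = 0 →
      x ∈ (affineSpan ℝ {r, s} : AffineSubspace ℝ (ℝ × ℝ)) := by
    intro x hx
    rw [mem_affineSpan_pair_iff_exists_lineMap_eq]
    rw [orient_eq] at hx
    by_cases h1 : s.1 - r.1 = 0
    · have h2 : s.2 - r.2 ≠ 0 := by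
        intro h2
        apply h
        simp [orient_eq, h1, h2]
      refine ⟨(x.2 - r.2) / (s.2 - r.2), ?_⟩
      apply Prod.ext
      · have : x.1 - r.1 = 0 := by
          rw [h1] at hx
          have h3 : (s.2 - r.2) * (x.1 - r.1) = 0 := by linarith
          exact (mul_eq_zero.mp h3).resolve_left h2
        simp [AffineMap.lineMap_apply, h1]
        linarith
      · simp [AffineMap.lineMap_apply]
        field_simp
        ring
    · refine ⟨(x.1 - r.1) / (s.1 - r.1), ?_⟩
      apply Prod.ext
      · simp [AffineMap.lineMap_apply]
        field_simp
        ring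
      · simp [AffineMap.lineMap_apply]
        field_simp
        linarith
  ext x
  simp only [Set.mem_inter_iff, SetLike.mem_coe, Set.mem_singleton_iff]
  constructor
  · rintro ⟨h1, h2⟩
    obtain ⟨t, rfl⟩ := mem_affineSpan_pair_iff_exists_lineMap_eq.mp h1
    have h3 := mem_zero _ h2
    rw [key] at h3
    unfold lineInter
    congr 1
    rw [eq_div_iff h']
    linarith
  · rintro rfl
    refine ⟨AffineMap.lineMap_mem_affineSpan_pair _ _ _, zero_mem _ ?_⟩
    unfold lineInter
    rw [key, div_mul_cancel₀ _ h', sub_self]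

/-- The linear map `L_A : ℝ³ → ℝ³`,
`L_A v = n v - ∑ⱼ (|uⱼ₋₁, v, uⱼ₊₁| / |uⱼ₋₁, uⱼ, uⱼ₊₁|) uⱼ`, where `uⱼ = (xⱼ, yⱼ, 1)`. -/
def glickMap {n : ℕ} [NeZero n] (A : ZMod n → ℝ × ℝ) : (Fin 3 → ℝ) →ₗ[ℝ] (Fin 3 → ℝ) where
  toFun v := (n : ℝ) • v - ∑ j : ZMod n,
    (det3 (lift (A (j - 1))) v (lift (A (j + 1))) /
      det3 (lift (A (j - 1))) (lift (A j)) (lift (A (j + 1)))) • lift (A j)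
  map_add' v w := by
    have h : ∀ a b : Fin 3 → ℝ, det3 a (v + w) b = det3 a v b + det3 a w b := by
      intro a b
      simp [det3, Matrix.det_fin_three]
      ring
    simp only [h, add_div, add_smul, Finset.sum_add_distrib, smul_add]
    abel
  map_smul' c v := by
    have h : ∀ a b : Fin 3 → ℝ, det3 a (c • v) b = c * det3 a v b := by
      intro a b
      simp [det3, Matrix.det_fin_three]
      ring
    simp only [h, mul_div_assoc, mul_smul, ← Finset.smul_sum, RingHom.id_apply, smul_sub]
    rw [smul_comm]

/-- The `3 × 3` matrix of `L_A` in the standard basis. -/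
def glickMatrix {n : ℕ} [NeZero n] (A : ZMod n → ℝ × ℝ) : Matrix (Fin 3) (Fin 3) ℝ :=
  LinearMap.toMatrix' (glickMap A)

/-- The field `ℚ(x₁, y₁, …, xₙ, yₙ)` generated by the coordinates of the vertices. -/
def coordField {n : ℕ} (A : ZMod n → ℝ × ℝ) : IntermediateField ℚ ℝ :=
  IntermediateField.adjoin ℚ (Set.range (fun i => (A i).1) ∪ Set.range (fun i => (A i).2))

end Pentagram

end

/-!
Glick's argument. Let `u i = lift (A i)`. The vector `v - (|u (j-1), v, u (j+1)| / |u (j-1), u j,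
u (j+1)|) u j` is the projection of `v` onto the plane spanned by `u (j-1)` and `u (j+1)` along
`u j`, and `L_A v` is the sum of these projections. Expanding them in the vertices of `T A`, for the
summands of `L_A` as well as for those of `L_(T A)`, shows that `L_(T A) = L_A`.

Convergence: the last coordinate of `L_A v` is bounded on the polygon `A`, hence, by invariance, on
all the polygons `T^k A` inside it. This coordinate bounds the reciprocal of the weight of the first
endpoint in the expression of a vertex of `T^(k+1) A` as a convex combination of the ends of a
diagonal of `T^k A`. So these weights stay away from `0`, each vertex of `T A` inherits a fixed
share of two adjacent vertices of `A`, and `n` steps of `T` mix all the vertices: they shrink the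
range of a linear form on the polygon by a fixed factor.

The limit point: a linear form that is positive at the limit is positive on `T^k A` for large `k`,
hence nonnegative at the image of the limit under `L_(T^k A) = L_A`, because `L_A` maps the cone
over `A` into itself. So the limit is an eigenvector. As `L_A` even maps the nonzero vectors of the
cone into its interior, the eigenspace is a line, and an eigenvector with a coordinate `1` that
spans its eigenspace is defined over the field generated by the eigenvalue.
-/

namespace Pentagram

open Filter Topology
open scoped Matrix IntermediateField

section LinearAlgebra

variable {K V ι : Type*} [Field K] [AddCommGroup V] [Module K V]

theorem sum_div_smul_eq_of_biorthogonal [FiniteDimensional K V] [Fintype ι]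
    (hcard : Fintype.card ι = Module.finrank K V) {f : ι → Module.Dual K V} {e : ι → V}
    (hne : ∀ i, f i (e i) ≠ 0) (hzero : Pairwise fun i j => f i (e j) = 0) (v : V) :
    ∑ i, (f i v / f i (e i)) • e i = v := by
  classical
  have apply_sum (c : ι → K) (j : ι) : f j (∑ i, c i • e i) = c j * f j (e j) := by
    rw [map_sum, Finset.sum_eq_single j (fun i _ hij => by simp [hzero hij.symm]) (by simp),
      map_smul, smul_eq_mul]
  have hli : LinearIndependent K e := Fintype.linearIndependent_iff.mpr fun c hc j => by
    simpa [hc, hne j] using apply_sum c j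
  obtain ⟨c, rfl⟩ : ∃ c : ι → K, ∑ i, c i • e i = v := by
    rw [← Submodule.mem_span_range_iff_exists_fun, hli.span_eq_top_of_card_eq_finrank' hcard]
    exact Submodule.mem_top
  simp only [apply_sum, mul_div_cancel_right₀ _ (hne _)]

theorem sub_div_smul_eq_of_biorthogonal (hV : Module.finrank K V = 3) {a b c : V}
    {f g h : Module.Dual K V} (hfa : f a ≠ 0) (hgb : g b ≠ 0) (hhc : h c ≠ 0)
    (hfb : f b = 0) (hfc : f c = 0) (hga : g a = 0) (hgc : g c = 0) (hha : h a = 0)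
    (hhb : h b = 0) (v : V) :
    v - (g v / g b) • b = (f v / f a) • a + (h v / h c) • c := by
  have : FiniteDimensional K V := Module.finite_of_finrank_eq_succ hV
  have := sum_div_smul_eq_of_biorthogonal (f := ![f, g, h]) (e := ![a, b, c]) (by simp [hV])
    (by simp [Fin.forall_fin_succ, *]) (by simp [Pairwise, Fin.forall_fin_succ, *]) v
  simp only [Fin.sum_univ_three, Matrix.cons_val] at this
  nth_rewrite 1 [← this]
  abel

variable [LinearOrder K] [IsStrictOrderedRing K]

theorem mem_span_singleton_of_forall_dual {p w : V} (hp : p ≠ 0)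
    (h : ∀ l : Module.Dual K V, 0 < l p → 0 ≤ l w) : w ∈ Submodule.span K {p} := by
  by_contra hw
  obtain ⟨f, hfw, hfp⟩ := Submodule.exists_le_ker_of_notMem hw
  have hfp : f p = 0 := hfp (Submodule.mem_span_singleton_self p)
  obtain ⟨m, hm⟩ := Module.Projective.exists_dual_eq_one K hp
  have := h (m - ((m w + 1) / f w) • f) (by simp [hm, hfp])
  simp only [LinearMap.sub_apply, LinearMap.smul_apply, smul_eq_mul, div_mul_cancel₀ _ hfw] at this
  linarith

theorem exists_eq_smul_of_strictly_positive [Finite ι] [Nonempty ι]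
    {f : ι → Module.Dual K V} {L : Module.End K V}
    (hL : ∀ v, v ≠ 0 → (∀ i, 0 ≤ f i v) → ∀ i, 0 < f i (L v)) {p w : V} {c : K} (hp : p ≠ 0)
    (hfp : ∀ i, 0 ≤ f i p) (hLp : L p = c • p) (hLw : L w = c • w) : ∃ r : K, w = r • p := by
  have hpos (i : ι) : 0 < f i p := (hfp i).lt_of_ne' fun h => by
    simpa [hLp, h] using hL p hp hfp i
  -- `w - r • p`, with `r` the least of the ratios `f i w / f i p`, is on the boundary of the cone.
  obtain ⟨i, hi⟩ := Finite.exists_min fun i => f i w / f i p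
  refine ⟨f i w / f i p, ?_⟩
  by_contra hne
  have hz (j : ι) : 0 ≤ f j (w - (f i w / f i p) • p) := by
    simpa [← le_div_iff₀ (hpos j)] using hi j
  have := hL _ (sub_ne_zero.mpr hne) hz i
  simp [hLp, hLw, smul_comm _ c, (hpos i).ne'] at this

end LinearAlgebra

section ZeroParam

variable {K V : Type*} [Field K] [AddCommGroup V] [Module K V] (f : Module.Dual K V) (a b : V)

/-- The parameter at which the line `t ↦ AffineMap.lineMap a b t` meets the kernel of the linear
form `f`. It is meaningful only when `f a ≠ f b`, and is `0` otherwise. -/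
def zeroParam : K := f a / (f a - f b)

theorem zeroParam_neg : zeroParam (-f) a b = zeroParam f a b := by
  simp only [zeroParam, LinearMap.neg_apply]
  rw [neg_sub_neg, ← neg_sub, neg_div_neg_eq]

variable {f a b}

theorem apply_lineMap_zeroParam (h : f a ≠ f b) :
    f (AffineMap.lineMap a b (zeroParam f a b)) = 0 := by
  have := sub_ne_zero.mpr h
  simp only [zeroParam, AffineMap.lineMap_apply_module, map_add, map_smul, smul_eq_mul]
  field_simp
  ring

theorem inv_one_sub_zeroParam (hb : f b ≠ 0) (h : f a ≠ f b) :
    (1 - zeroParam f a b)⁻¹ = 1 - f a / f b := by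
  have := sub_ne_zero.mpr h
  rw [zeroParam, one_sub_div this, one_sub_div hb, inv_div, sub_sub_cancel_left, div_neg,
    ← neg_div, neg_sub]

theorem zeroParam_mem_Ioo [LinearOrder K] [IsStrictOrderedRing K] (h : f a * f b < 0) :
    zeroParam f a b ∈ Set.Ioo 0 1 := by
  rcases mul_neg_iff.mp h with ⟨ha, hb⟩ | ⟨ha, hb⟩
  · have : 0 < f a - f b := by linarith
    exact ⟨div_pos ha this, (div_lt_one this).mpr (by linarith)⟩
  · have : f a - f b < 0 := by linarith
    exact ⟨div_pos_of_neg_of_neg ha this, (div_lt_one_of_neg this).mpr (by linarith)⟩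

end ZeroParam

section Oscillation

theorem exists_tendsto_of_oscillation_le {ι : Type*} [Finite ι] [Nonempty ι] {f : ℕ → ι → ℝ}
    (hsup : Antitone fun k => ⨆ i, f k i) (hinf : Monotone fun k => ⨅ i, f k i) {ε : ℝ}
    (hε : 0 < ε) {N : ℕ}
    (h : ∀ k i j, (⨅ m, f k m) + ε * (f k j - ⨅ m, f k m) ≤ f (k + N) i) :
    ∃ x, ∀ i, Tendsto (fun k => f k i) atTop (𝓝 x) := by
  have inf_le (k i) : ⨅ m, f k m ≤ f k i := ciInf_le (Set.finite_range _).bddBelow i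
  have le_sup (k i) : f k i ≤ ⨆ m, f k m := le_ciSup (Set.finite_range _).bddAbove i
  have inf_le_sup (k l) : ⨅ i, f k i ≤ ⨆ i, f l i := by
    obtain ⟨i⟩ := ‹Nonempty ι›
    exact (hinf (le_max_left k l)).trans
      ((inf_le _ i).trans ((le_sup _ i).trans (hsup (le_max_right k l))))
  have tendsto_inf : Tendsto (fun k => ⨅ i, f k i) atTop (𝓝 (⨆ k, ⨅ i, f k i)) :=
    tendsto_atTop_ciSup hinf ⟨_, Set.forall_mem_range.mpr fun k => inf_le_sup k 0⟩
  have tendsto_sup : Tendsto (fun k => ⨆ i, f k i) atTop (𝓝 (⨅ k, ⨆ i, f k i)) :=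
    tendsto_atTop_ciInf hsup ⟨_, Set.forall_mem_range.mpr fun k => inf_le_sup 0 k⟩
  set a := ⨆ k, ⨅ i, f k i
  set b := ⨅ k, ⨆ i, f k i
  have hab : a ≤ b := le_of_tendsto_of_tendsto' tendsto_inf tendsto_sup fun k => inf_le_sup k k
  have hstep (k) : (⨅ i, f k i) + ε * ((⨆ i, f k i) - ⨅ i, f k i) ≤ ⨅ i, f (k + N) i := by
    obtain ⟨j, hj⟩ := exists_eq_ciSup_of_finite (f := f k)
    exact le_ciInf fun i => hj ▸ h k i j
  have hlim : a + ε * (b - a) ≤ a := le_of_tendsto_of_tendsto'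
    (tendsto_inf.add ((tendsto_sup.sub tendsto_inf).const_mul ε))
    ((tendsto_add_atTop_iff_nat N).mpr tendsto_inf) hstep
  have hba : b ≤ a := by nlinarith
  rw [le_antisymm hba hab] at tendsto_sup
  exact ⟨a, fun i => tendsto_of_tendsto_of_tendsto_of_le_of_le tendsto_inf tendsto_sup
    (fun k => inf_le k i) fun k => le_sup k i⟩

end Oscillation

section Field

variable {ι k L : Type*} [Fintype ι] [Field k] [Field L] [Algebra k L] {N : Matrix ι ι k}

theorem exists_mulVec_eq_smul_iff_isRoot_charpoly [DecidableEq ι] {c : k} :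
    (∃ v, v ≠ 0 ∧ N *ᵥ v = c • v) ↔ N.charpoly.IsRoot c := by
  rw [← N.charpoly_toLin', ← Module.End.hasEigenvalue_iff_isRoot_charpoly,
    Module.End.hasEigenvalue_iff, Submodule.ne_bot_iff]
  simp only [Module.End.mem_eigenspace_iff, Matrix.toLin'_apply, and_comm]

theorem exists_map_mulVec_eq_smul_iff_aeval_charpoly [DecidableEq ι] {c : L} :
    (∃ v, v ≠ 0 ∧ N.map (algebraMap k L) *ᵥ v = c • v) ↔ N.charpoly.aeval c = 0 := by
  rw [exists_mulVec_eq_smul_iff_isRoot_charpoly, Matrix.charpoly_map, Polynomial.IsRoot,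
    Polynomial.eval_map_algebraMap]

theorem finrank_adjoin_le_natDegree {P : Polynomial k} {c : L} (hP : P ≠ 0)
    (hc : P.aeval c = 0) : Module.finrank k k⟮c⟯ ≤ P.natDegree := by
  rw [IntermediateField.adjoin.finrank (isAlgebraic_iff_isIntegral.mp ⟨P, hP, hc⟩)]
  exact Polynomial.natDegree_le_of_dvd (minpoly.dvd k c hc) hP

theorem mem_range_algebraMap_of_forall_eigenvector {c : k} {v : ι → L} {j : ι} (hj : v j = 1)
    (hv : N.map (algebraMap k L) *ᵥ v = algebraMap k L c • v)
    (huniq : ∀ w, N.map (algebraMap k L) *ᵥ w = algebraMap k L c • w → ∃ r : L, w = r • v)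
    (i : ι) : v i ∈ (algebraMap k L).range := by
  classical
  have hv0 : v ≠ 0 := fun h => by simp [h] at hj
  have hroot := exists_map_mulVec_eq_smul_iff_aeval_charpoly.mp ⟨v, hv0, hv⟩
  rw [Polynomial.aeval_algebraMap_apply, map_eq_zero] at hroot
  obtain ⟨w, hw0, hw⟩ := exists_mulVec_eq_smul_iff_isRoot_charpoly.mpr hroot
  obtain ⟨r, hr⟩ := huniq (algebraMap k L ∘ w) <| by
    ext m
    rw [← RingHom.map_mulVec, hw]
    simp
  have hwr (m : ι) : algebraMap k L (w m) = r * v m := congrFun hr m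
  have hr0 : r ≠ 0 := fun h => hw0 <| funext fun m => by simpa [h] using hwr m
  exact ⟨w i / w j, by rw [map_div₀, hwr, hwr, hj, mul_one, mul_div_cancel_left₀ _ hr0]⟩

theorem mem_adjoin_of_forall_eigenvector {c : L} {v : ι → L} {j : ι} (hj : v j = 1)
    (hv : N.map (algebraMap k L) *ᵥ v = c • v)
    (huniq : ∀ w, N.map (algebraMap k L) *ᵥ w = c • w → ∃ r : L, w = r • v) (i : ι) :
    v i ∈ k⟮c⟯ := by
  have hmap : (N.map (algebraMap k k⟮c⟯)).map (algebraMap k⟮c⟯ L) = N.map (algebraMap k L) := rfl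
  obtain ⟨x, hx⟩ := mem_range_algebraMap_of_forall_eigenvector
    (N := N.map (algebraMap k k⟮c⟯)) (c := IntermediateField.AdjoinSimple.gen k c) hj
    (by simpa [hmap] using hv) (by simpa [hmap] using huniq) i
  exact hx ▸ x.2

end Field

section Forms

@[simp] theorem lift_two (p : ℝ × ℝ) : lift p 2 = 1 := rfl

theorem lift_ne_zero (p : ℝ × ℝ) : lift p ≠ 0 := fun h => by simpa using congrFun h 2

theorem lift_lineMap (p q : ℝ × ℝ) (t : ℝ) :
    lift (AffineMap.lineMap p q t) = AffineMap.lineMap (lift p) (lift q) t := by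
  ext k
  fin_cases k <;> simp [lift, AffineMap.lineMap_apply]

theorem det3_eq (a b c : Fin 3 → ℝ) : det3 a b c =
    a 0 * (b 1 * c 2 - b 2 * c 1) - a 1 * (b 0 * c 2 - b 2 * c 0)
      + a 2 * (b 0 * c 1 - b 1 * c 0) := by
  simp only [det3, Matrix.det_fin_three, Matrix.of_apply, Matrix.cons_val]
  ring

/-- The linear form `v ↦ |a, b, v|` on `ℝ³`, whose kernel is the plane over the line through the
points represented by `a` and `b`. -/
noncomputable def detForm (a b : Fin 3 → ℝ) : Module.Dual ℝ (Fin 3 → ℝ) where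
  toFun v := det3 a b v
  map_add' v w := by simp only [det3_eq, Pi.add_apply]; ring
  map_smul' c v := by simp only [det3_eq, Pi.smul_apply, smul_eq_mul, RingHom.id_apply]; ring

theorem detForm_apply (a b v : Fin 3 → ℝ) : detForm a b v = det3 a b v := rfl

@[simp] theorem detForm_left (a b : Fin 3 → ℝ) : detForm a b a = 0 := by
  rw [detForm_apply, det3_eq]; ring

@[simp] theorem detForm_right (a b : Fin 3 → ℝ) : detForm a b b = 0 := by
  rw [detForm_apply, det3_eq]; ring

theorem detForm_rotate (a b c : Fin 3 → ℝ) : detForm a b c = detForm b c a := by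
  simp only [detForm_apply, det3_eq]; ring

theorem neg_detForm (a b : Fin 3 → ℝ) : -detForm a b = detForm b a := by
  refine LinearMap.ext fun v => ?_
  simp only [LinearMap.neg_apply, detForm_apply, det3_eq]; ring

theorem detForm_lineMap_lineMap (a b : Fin 3 → ℝ) (s t : ℝ) :
    detForm (AffineMap.lineMap a b s) (AffineMap.lineMap a b t) = (t - s) • detForm a b := by
  refine LinearMap.ext fun v => ?_
  simp only [LinearMap.smul_apply, smul_eq_mul, detForm_apply, det3_eq,
    AffineMap.lineMap_apply_module, Pi.add_apply, Pi.smul_apply]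
  ring

variable {n : ℕ} (A : ZMod n → ℝ × ℝ)

/-- The linear form that vanishes on the side `A i, A (i + 1)`; it is nonnegative on a polygon
with counterclockwise vertices. -/
noncomputable def edgeForm (i : ZMod n) : Module.Dual ℝ (Fin 3 → ℝ) :=
  detForm (lift (A i)) (lift (A (i + 1)))

/-- The linear form that vanishes on the diagonal `A (i - 1), A (i + 1)`; on a polygon with
counterclockwise vertices it is positive at `A i` and negative at the vertices that the diagonal
separates from `A i`. -/
noncomputable def diagForm (i : ZMod n) : Module.Dual ℝ (Fin 3 → ℝ) :=
  detForm (lift (A (i + 1))) (lift (A (i - 1)))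

theorem edgeForm_self (i : ZMod n) : edgeForm A i (lift (A i)) = 0 := detForm_left _ _

theorem edgeForm_add_one (i : ZMod n) : edgeForm A i (lift (A (i + 1))) = 0 := detForm_right _ _

theorem edgeForm_sub_one_self (i : ZMod n) : edgeForm A (i - 1) (lift (A i)) = 0 := by
  simp [edgeForm]

theorem diagForm_add_one (i : ZMod n) : diagForm A i (lift (A (i + 1))) = 0 := detForm_left _ _

theorem diagForm_sub_one (i : ZMod n) : diagForm A i (lift (A (i - 1))) = 0 := detForm_right _ _

theorem diagForm_self (i : ZMod n) :
    diagForm A i (lift (A i)) = edgeForm A i (lift (A (i - 1))) :=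
  (detForm_rotate _ _ _).symm

theorem diagForm_apply (i : ZMod n) (v : Fin 3 → ℝ) :
    diagForm A i v = det3 (lift (A (i - 1))) v (lift (A (i + 1))) := by
  rw [diagForm, detForm_rotate, detForm_apply]

theorem glickMap_apply_eq_sum [NeZero n] (v : Fin 3 → ℝ) : glickMap A v =
    ∑ j, (v - (diagForm A j v / diagForm A j (lift (A j))) • lift (A j)) := by
  simp [glickMap, diagForm_apply, Finset.sum_sub_distrib, ← Nat.cast_smul_eq_nsmul ℝ]

end Forms

section Convex

theorem ofNat_ne_zero {n k : ℕ} [k.AtLeastTwo] (h : k < n) : (ofNat(k) : ZMod n) ≠ 0 := fun hk =>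
  (Nat.le_of_dvd (Nat.pos_of_neZero k) ((ZMod.natCast_eq_zero_iff k n).mp hk)).not_gt h

/-- Strict convexity with the vertices in counterclockwise order. -/
def IsPositive {n : ℕ} (A : ZMod n → ℝ × ℝ) : Prop :=
  ∀ i j : ZMod n, j ≠ i → j ≠ i + 1 → 0 < edgeForm A i (lift (A j))

namespace IsPositive

variable {n : ℕ} {A : ZMod n → ℝ × ℝ}

theorem edgeForm_nonneg (hA : IsPositive A) (i j : ZMod n) : 0 ≤ edgeForm A i (lift (A j)) := by
  by_cases h : j = i
  · rw [h, edgeForm_self]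
  by_cases h' : j = i + 1
  · rw [h', edgeForm_add_one]
  exact (hA i j h h').le

theorem edgeForm_sub_one_pos (hA : IsPositive A) (hn : 3 ≤ n) (i : ZMod n) :
    0 < edgeForm A i (lift (A (i - 1))) := by
  have h2 : (2 : ZMod n) ≠ 0 := ofNat_ne_zero (by lia)
  exact hA _ _ (fun h => h2 (by linear_combination -2 * h)) (fun h => h2 (by linear_combination -h))

theorem edgeForm_add_two_pos (hA : IsPositive A) (hn : 3 ≤ n) (i : ZMod n) :
    0 < edgeForm A i (lift (A (i + 2))) := by
  have h2 : (2 : ZMod n) ≠ 0 := ofNat_ne_zero (by lia)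
  exact hA _ _ (fun h => h2 (by linear_combination h)) (fun h => h2 (by linear_combination 2 * h))

theorem edgeForm_sub_one_add_one_pos (hA : IsPositive A) (hn : 3 ≤ n) (i : ZMod n) :
    0 < edgeForm A (i - 1) (lift (A (i + 1))) := by
  have := hA.edgeForm_add_two_pos hn (i - 1)
  rwa [sub_add, show (1 : ZMod n) - 2 = -1 by ring, sub_neg_eq_add] at this

theorem diagForm_self_pos (hA : IsPositive A) (hn : 3 ≤ n) (i : ZMod n) :
    0 < diagForm A i (lift (A i)) :=
  diagForm_self A i ▸ hA.edgeForm_sub_one_pos hn i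

theorem sub_div_smul_lift_eq (hA : IsPositive A) (hn : 3 ≤ n) (i : ZMod n) (v : Fin 3 → ℝ) :
    v - (diagForm A i v / diagForm A i (lift (A i))) • lift (A i) =
      (edgeForm A i v / edgeForm A i (lift (A (i - 1)))) • lift (A (i - 1)) +
        (edgeForm A (i - 1) v / edgeForm A (i - 1) (lift (A (i + 1)))) • lift (A (i + 1)) :=
  sub_div_smul_eq_of_biorthogonal (by simp) (hA.edgeForm_sub_one_pos hn i).ne'
    (hA.diagForm_self_pos hn i).ne' (hA.edgeForm_sub_one_add_one_pos hn i).ne'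
    (edgeForm_self A i) (edgeForm_add_one A i) (diagForm_sub_one A i) (diagForm_add_one A i)
    (edgeForm_self A _) (edgeForm_sub_one_self A i) v

theorem diagForm_neg (hA : IsPositive A) (hn : 3 ≤ n) {i m : ZMod n} (hp : m ≠ i - 1)
    (h0 : m ≠ i) (hs : m ≠ i + 1) : diagForm A i (lift (A m)) < 0 := by
  have h2 : (2 : ZMod n) ≠ 0 := ofNat_ne_zero (by lia)
  have hsub := congrArg (edgeForm A m) (hA.sub_div_smul_lift_eq hn i (lift (A m)))
  simp only [map_sub, map_add, map_smul, smul_eq_mul, edgeForm_self, zero_sub] at hsub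
  have hc : 0 < edgeForm A i (lift (A m)) / edgeForm A i (lift (A (i - 1))) :=
    div_pos (hA _ _ h0 hs) (hA.edgeForm_sub_one_pos hn i)
  have hd : 0 < edgeForm A (i - 1) (lift (A m)) / edgeForm A (i - 1) (lift (A (i + 1))) :=
    div_pos (hA _ _ hp (by simpa using h0)) (hA.edgeForm_sub_one_add_one_pos hn i)
  have hlt : diagForm A i (lift (A m)) / diagForm A i (lift (A i)) *
      edgeForm A m (lift (A i)) < 0 := by
    rw [← neg_pos, hsub]
    by_cases h : i - 1 = m + 1
    · exact add_pos_of_nonneg_of_pos (mul_nonneg hc.le (hA.edgeForm_nonneg _ _))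
        (mul_pos hd (hA _ _ hs.symm fun h' => h2 (by linear_combination h' - h)))
    · exact add_pos_of_pos_of_nonneg (mul_pos hc (hA _ _ hp.symm h))
        (mul_nonneg hd.le (hA.edgeForm_nonneg _ _))
  have := neg_of_mul_neg_left hlt (hA.edgeForm_nonneg _ _)
  exact (div_neg_iff.mp this).resolve_left (fun h => h.2.not_gt (hA.diagForm_self_pos hn i)) |>.1

theorem diagForm_nonpos (hA : IsPositive A) (hn : 3 ≤ n) {i m : ZMod n} (h : m ≠ i) :
    diagForm A i (lift (A m)) ≤ 0 := by
  by_cases hp : m = i - 1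
  · rw [hp, diagForm_sub_one]
  by_cases hs : m = i + 1
  · rw [hs, diagForm_add_one]
  exact (hA.diagForm_neg hn hp h hs).le

end IsPositive

end Convex

section PentagramMap

theorem lineInter_comm {p q r s : ℝ × ℝ} (h : orient r s p ≠ orient r s q) :
    lineInter p q r s = lineInter r s p q := by
  have h' : orient p q r ≠ orient p q s := by
    rw [← sub_ne_zero] at h ⊢
    rw [← neg_ne_zero]
    convert h using 1
    simp only [orient_eq]
    ring
  rw [← Set.singleton_eq_singleton_iff, ← line_inf_line_eq h, ← line_inf_line_eq h',
    Set.inter_comm]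

variable {n : ℕ} (A : ZMod n → ℝ × ℝ)

/-- The parameter of the vertex `pentagramMap A i` on the diagonal `A (i - 1), A (i + 1)`. -/
noncomputable def fstParam (i : ZMod n) : ℝ :=
  zeroParam (diagForm A (i + 1)) (lift (A (i - 1))) (lift (A (i + 1)))

/-- The parameter of the vertex `pentagramMap A i` on the diagonal `A i, A (i + 2)`. -/
noncomputable def sndParam (i : ZMod n) : ℝ :=
  zeroParam (diagForm A i) (lift (A i)) (lift (A (i + 2)))

theorem lift_pentagramMap_eq_fst (i : ZMod n) : lift (pentagramMap A i) =
    AffineMap.lineMap (lift (A (i - 1))) (lift (A (i + 1))) (fstParam A i) := by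
  rw [fstParam, ← zeroParam_neg, diagForm, neg_detForm, add_sub_cancel_right, add_assoc,
    one_add_one_eq_two]
  exact lift_lineMap _ _ _

theorem diagForm_pentagramMap (i : ZMod n) : diagForm A i (lift (pentagramMap A i)) = 0 := by
  rw [lift_pentagramMap_eq_fst, AffineMap.lineMap_apply_module, map_add, map_smul, map_smul,
    diagForm_sub_one, diagForm_add_one, smul_zero, smul_zero, add_zero]

variable {A}

namespace IsPositive

theorem diagForm_add_one_sub_one_neg (hA : IsPositive A) (hn : 4 ≤ n) (i : ZMod n) :
    diagForm A (i + 1) (lift (A (i - 1))) < 0 := by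
  have h2 : (2 : ZMod n) ≠ 0 := ofNat_ne_zero (by lia)
  have h3 : (3 : ZMod n) ≠ 0 := ofNat_ne_zero (by lia)
  exact hA.diagForm_neg (by lia) (fun h => h2 (by linear_combination -2 * h))
    (fun h => h2 (by linear_combination -h)) (fun h => h3 (by linear_combination -h))

theorem diagForm_add_two_neg (hA : IsPositive A) (hn : 4 ≤ n) (i : ZMod n) :
    diagForm A i (lift (A (i + 2))) < 0 := by
  have h2 : (2 : ZMod n) ≠ 0 := ofNat_ne_zero (by lia)
  have h3 : (3 : ZMod n) ≠ 0 := ofNat_ne_zero (by lia)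
  exact hA.diagForm_neg (by lia) (fun h => h3 (by linear_combination h))
    (fun h => h2 (by linear_combination h)) (fun h => h2 (by linear_combination 2 * h))

theorem fstParam_mem_Ioo (hA : IsPositive A) (hn : 4 ≤ n) (i : ZMod n) :
    fstParam A i ∈ Set.Ioo 0 1 :=
  zeroParam_mem_Ioo (mul_neg_of_neg_of_pos (hA.diagForm_add_one_sub_one_neg hn i)
    (hA.diagForm_self_pos (by lia) _))

theorem sndParam_mem_Ioo (hA : IsPositive A) (hn : 4 ≤ n) (i : ZMod n) :
    sndParam A i ∈ Set.Ioo 0 1 :=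
  zeroParam_mem_Ioo (mul_neg_of_pos_of_neg (hA.diagForm_self_pos (by lia) _)
    (hA.diagForm_add_two_neg hn i))

theorem diagForm_add_one_pentagramMap (hA : IsPositive A) (hn : 4 ≤ n) (i : ZMod n) :
    diagForm A (i + 1) (lift (pentagramMap A i)) = 0 := by
  rw [lift_pentagramMap_eq_fst]
  exact apply_lineMap_zeroParam
    ((hA.diagForm_add_one_sub_one_neg hn i).trans (hA.diagForm_self_pos (by lia) _)).ne

theorem lift_pentagramMap_eq_snd (hA : IsPositive A) (hn : 4 ≤ n) (i : ZMod n) :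
    lift (pentagramMap A i) =
      AffineMap.lineMap (lift (A i)) (lift (A (i + 2))) (sndParam A i) := by
  have hne : orient (A i) (A (i + 2)) (A (i - 1)) ≠ orient (A i) (A (i + 2)) (A (i + 1)) := by
    have := (hA.diagForm_add_one_sub_one_neg hn i).trans (hA.diagForm_self_pos (by lia) (i + 1))
    rw [diagForm, ← neg_detForm, add_sub_cancel_right, add_assoc, one_add_one_eq_two] at this
    exact (neg_lt_neg_iff.mp this).ne'
  rw [pentagramMap, lineInter_comm hne, sndParam, ← zeroParam_neg, diagForm, neg_detForm]
  exact lift_lineMap _ _ _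

theorem diagForm_pentagramMap_add_one_neg (hA : IsPositive A) (hn : 5 ≤ n) (i : ZMod n) :
    diagForm A i (lift (pentagramMap A (i + 1))) < 0 := by
  have h2 : (2 : ZMod n) ≠ 0 := ofNat_ne_zero (by lia)
  have h3 : (3 : ZMod n) ≠ 0 := ofNat_ne_zero (by lia)
  have h4 : (4 : ZMod n) ≠ 0 := ofNat_ne_zero (by lia)
  rw [hA.lift_pentagramMap_eq_snd (by lia), AffineMap.lineMap_apply_module, map_add, map_smul,
    map_smul, diagForm_add_one, smul_zero, zero_add]
  exact mul_neg_of_pos_of_neg (hA.sndParam_mem_Ioo (by lia) _).1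
    (hA.diagForm_neg (by lia) (fun h => h4 (by linear_combination h))
      (fun h => h3 (by linear_combination h)) (fun h => h2 (by linear_combination h)))

theorem diagForm_pentagramMap_neg (hA : IsPositive A) (hn : 5 ≤ n) {i m : ZMod n}
    (hp : m ≠ i - 1) (h0 : m ≠ i) : diagForm A i (lift (pentagramMap A m)) < 0 := by
  have h2 : (2 : ZMod n) ≠ 0 := ofNat_ne_zero (by lia)
  have h4 : (4 : ZMod n) ≠ 0 := ofNat_ne_zero (by lia)
  by_cases hs : m = i + 1
  · exact hs ▸ hA.diagForm_pentagramMap_add_one_neg hn i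
  obtain ⟨ht0, ht1⟩ := hA.fstParam_mem_Ioo (by lia) m
  have hm' : m - 1 ≠ i := fun h => hs (by linear_combination h)
  have hm : m + 1 ≠ i := fun h => hp (by linear_combination h)
  rw [lift_pentagramMap_eq_fst, AffineMap.lineMap_apply_module, map_add, map_smul, map_smul]
  by_cases h : m + 1 = i - 1
  · refine add_neg_of_neg_of_nonpos (mul_neg_of_pos_of_neg (sub_pos.mpr ht1) ?_)
      (mul_nonpos_of_nonneg_of_nonpos ht0.le (hA.diagForm_nonpos (by lia) hm))
    exact hA.diagForm_neg (by lia) (fun h' => h2 (by linear_combination h - h')) hm'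
      (fun h' => h4 (by linear_combination h - h'))
  · exact add_neg_of_nonpos_of_neg
      (mul_nonpos_of_nonneg_of_nonpos (sub_pos.mpr ht1).le (hA.diagForm_nonpos (by lia) hm'))
      (mul_neg_of_pos_of_neg ht0 (hA.diagForm_neg (by lia) h hm (by simpa using h0)))

theorem diagForm_add_one_pentagramMap_sub_one_neg (hA : IsPositive A) (hn : 5 ≤ n) (i : ZMod n) :
    diagForm A (i + 1) (lift (pentagramMap A (i - 1))) < 0 := by
  have h2 : (2 : ZMod n) ≠ 0 := ofNat_ne_zero (by lia)
  exact hA.diagForm_pentagramMap_neg hn (fun h => h2 (by linear_combination -2 * h))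
    (fun h => h2 (by linear_combination -h))

theorem sndParam_lt_fstParam_add_one (hA : IsPositive A) (hn : 5 ≤ n) (i : ZMod n) :
    sndParam A i < fstParam A (i + 1) := by
  have hlt : diagForm A i (lift (pentagramMap A (i + 1))) <
      diagForm A i (lift (pentagramMap A i)) := by
    rw [diagForm_pentagramMap]
    exact hA.diagForm_pentagramMap_add_one_neg hn i
  rw [lift_pentagramMap_eq_fst, hA.lift_pentagramMap_eq_snd (by lia), add_sub_cancel_right,
    add_assoc, one_add_one_eq_two] at hlt
  simp only [AffineMap.lineMap_apply_module, map_add, map_smul, smul_eq_mul] at hlt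
  have := hA.diagForm_self_pos (by lia) i
  have := hA.diagForm_add_two_neg (by lia) i
  nlinarith

theorem edgeForm_pentagramMap (hA : IsPositive A) (hn : 4 ≤ n) (i : ZMod n) :
    edgeForm (pentagramMap A) i = (sndParam A i - fstParam A (i + 1)) • diagForm A (i + 1) := by
  rw [edgeForm, hA.lift_pentagramMap_eq_snd hn, lift_pentagramMap_eq_fst, add_sub_cancel_right,
    add_assoc, one_add_one_eq_two, detForm_lineMap_lineMap, diagForm, add_sub_cancel_right,
    add_assoc, one_add_one_eq_two, ← neg_detForm, smul_neg, ← neg_smul, neg_sub]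

protected theorem pentagramMap (hA : IsPositive A) (hn : 5 ≤ n) : IsPositive (pentagramMap A) := by
  intro i j h0 hs
  rw [hA.edgeForm_pentagramMap (by lia)]
  exact mul_pos_of_neg_of_neg (sub_neg.mpr (hA.sndParam_lt_fstParam_add_one hn i))
    (hA.diagForm_pentagramMap_neg hn (by simpa using h0) hs)

theorem iterate_pentagramMap (hA : IsPositive A) (hn : 5 ≤ n) (k : ℕ) :
    IsPositive (pentagramMap^[k] A) :=
  Function.Iterate.rec IsPositive hA (fun _ h => h.pentagramMap hn) k

end IsPositive

end PentagramMap

namespace IsPositive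

variable {n : ℕ} {A : ZMod n → ℝ × ℝ}

section Convex

theorem lift_pentagramMap_mem (hA : IsPositive A) (hn : 4 ≤ n) {S : Set (Fin 3 → ℝ)}
    (hS : Convex ℝ S) (h : ∀ i, lift (A i) ∈ S) (i : ZMod n) : lift (pentagramMap A i) ∈ S := by
  rw [lift_pentagramMap_eq_fst]
  exact hS.lineMap_mem (h _) (h _) (Set.Ioo_subset_Icc_self (hA.fstParam_mem_Ioo hn i))

theorem lift_iterate_pentagramMap_mem (hA : IsPositive A) (hn : 5 ≤ n) {S : Set (Fin 3 → ℝ)}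
    (hS : Convex ℝ S) (h : ∀ i, lift (A i) ∈ S) (k : ℕ) (i : ZMod n) :
    lift (pentagramMap^[k] A i) ∈ S := by
  induction k generalizing i with
  | zero => exact h i
  | succ k ih =>
    rw [Function.iterate_succ_apply']
    exact (hA.iterate_pentagramMap hn k).lift_pentagramMap_mem (by lia) hS ih i

end Convex

section Glick

theorem sub_div_smul_lift_eq_pentagramMap (hA : IsPositive A) (hn : 5 ≤ n) (j : ZMod n)
    (v : Fin 3 → ℝ) :
    v - (diagForm A j v / diagForm A j (lift (A j))) • lift (A j) =
      (diagForm A (j + 1) v / diagForm A (j + 1) (lift (pentagramMap A (j - 1)))) •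
          lift (pentagramMap A (j - 1)) +
        (diagForm A (j - 1) v / diagForm A (j - 1) (lift (pentagramMap A j))) •
          lift (pentagramMap A j) := by
  have hneg : diagForm A (j - 1) (lift (pentagramMap A j)) < 0 := by
    simpa using hA.diagForm_pentagramMap_add_one_neg hn (j - 1)
  exact sub_div_smul_eq_of_biorthogonal (by simp)
    (hA.diagForm_add_one_pentagramMap_sub_one_neg hn j).ne
    (hA.diagForm_self_pos (by lia) j).ne' hneg.ne
    (by simpa using diagForm_sub_one A (j + 1)) (hA.diagForm_add_one_pentagramMap (by lia) j)
    (by simpa using hA.diagForm_add_one_pentagramMap (by lia) (j - 1)) (diagForm_pentagramMap A j)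
    (diagForm_pentagramMap A _) (by simpa using diagForm_add_one A (j - 1)) v

theorem sub_div_smul_lift_pentagramMap_eq (hA : IsPositive A) (hn : 5 ≤ n) (j : ZMod n)
    (v : Fin 3 → ℝ) :
    v - (diagForm (pentagramMap A) j v / diagForm (pentagramMap A) j (lift (pentagramMap A j))) •
        lift (pentagramMap A j) =
      (diagForm A (j + 1) v / diagForm A (j + 1) (lift (pentagramMap A (j - 1)))) •
          lift (pentagramMap A (j - 1)) +
        (diagForm A j v / diagForm A j (lift (pentagramMap A (j + 1)))) •
          lift (pentagramMap A (j + 1)) :=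
  sub_div_smul_eq_of_biorthogonal (by simp)
    (hA.diagForm_add_one_pentagramMap_sub_one_neg hn j).ne
    ((hA.pentagramMap hn).diagForm_self_pos (by lia) j).ne'
    (hA.diagForm_pentagramMap_add_one_neg hn j).ne
    (hA.diagForm_add_one_pentagramMap (by lia) j) (diagForm_pentagramMap A _)
    (diagForm_sub_one _ j) (diagForm_add_one _ j)
    (by simpa using hA.diagForm_add_one_pentagramMap (by lia) (j - 1)) (diagForm_pentagramMap A j) v

variable [NeZero n]

theorem glickMap_pentagramMap (hA : IsPositive A) (hn : 5 ≤ n) :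
    glickMap (pentagramMap A) = glickMap A := by
  refine LinearMap.ext fun v => ?_
  rw [glickMap_apply_eq_sum, glickMap_apply_eq_sum]
  simp only [hA.sub_div_smul_lift_pentagramMap_eq hn, hA.sub_div_smul_lift_eq_pentagramMap hn,
    Finset.sum_add_distrib]
  congr 1
  refine (Fintype.sum_equiv (Equiv.subRight 1) _ _ fun j => ?_).symm
  simp

theorem glickMap_iterate_pentagramMap (hA : IsPositive A) (hn : 5 ≤ n) (k : ℕ) :
    glickMap (pentagramMap^[k] A) = glickMap A := by
  induction k with
  | zero => rfl
  | succ k ih =>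
    rw [Function.iterate_succ_apply', (hA.iterate_pentagramMap hn k).glickMap_pentagramMap hn, ih]

end Glick

end IsPositive

section EdgeVector

variable {n : ℕ} (A : ZMod n → ℝ × ℝ)

/-- The vector whose coefficient in the expansion of `glickMap A v` is `edgeForm A j v`; it lies in
the cone spanned by the two vertices next to the side `A j, A (j + 1)`. -/
noncomputable def edgeVector (j : ZMod n) : Fin 3 → ℝ :=
  (edgeForm A j (lift (A (j - 1))))⁻¹ • lift (A (j - 1)) +
    (edgeForm A j (lift (A (j + 2))))⁻¹ • lift (A (j + 2))

variable {A}

namespace IsPositive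

theorem glickMap_apply_eq_sum_edgeVector [NeZero n] (hA : IsPositive A) (hn : 3 ≤ n)
    (v : Fin 3 → ℝ) : glickMap A v = ∑ j, edgeForm A j v • edgeVector A j := by
  rw [glickMap_apply_eq_sum]
  simp only [hA.sub_div_smul_lift_eq hn]
  simp only [edgeVector, smul_add, smul_smul, div_eq_mul_inv, Finset.sum_add_distrib]
  congr 1
  refine Fintype.sum_equiv (Equiv.subRight (1 : ZMod n)) _ _ fun j => ?_
  rw [Equiv.subRight_apply, show j - 1 + 2 = j + 1 by ring]

theorem glickMap_apply_nonneg [NeZero n] (hA : IsPositive A) (hn : 3 ≤ n)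
    {l : Module.Dual ℝ (Fin 3 → ℝ)} (hl : ∀ i, 0 ≤ l (lift (A i))) {v : Fin 3 → ℝ}
    (hv : ∀ i, 0 ≤ edgeForm A i v) : 0 ≤ l (glickMap A v) := by
  rw [hA.glickMap_apply_eq_sum_edgeVector hn, map_sum]
  refine Finset.sum_nonneg fun j _ => ?_
  rw [edgeVector, map_smul, map_add, map_smul, map_smul]
  have h (m) := inv_nonneg.mpr (hA.edgeForm_nonneg j m)
  exact mul_nonneg (hv j) (add_nonneg (mul_nonneg (h _) (hl _)) (mul_nonneg (h _) (hl _)))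

theorem edgeForm_edgeVector_pos (hA : IsPositive A) (hn : 5 ≤ n) (i j : ZMod n) :
    0 < edgeForm A i (edgeVector A j) := by
  have h2 : (2 : ZMod n) ≠ 0 := ofNat_ne_zero (by lia)
  have h3 : (3 : ZMod n) ≠ 0 := ofNat_ne_zero (by lia)
  have h4 : (4 : ZMod n) ≠ 0 := ofNat_ne_zero (by lia)
  have hp := inv_pos.mpr (hA.edgeForm_sub_one_pos (by lia) j)
  have hs := inv_pos.mpr (hA.edgeForm_add_two_pos (by lia) j)
  rw [edgeVector, map_add, map_smul, map_smul]
  by_cases h : j - 1 = i ∨ j - 1 = i + 1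
  · refine add_pos_of_nonneg_of_pos (mul_nonneg hp.le (hA.edgeForm_nonneg i _))
      (mul_pos hs (hA _ _ (fun h' => ?_) fun h' => ?_)) <;> rcases h with h | h
    · exact h3 (by linear_combination h' - h)
    · exact h4 (by linear_combination h' - h)
    · exact h2 (by linear_combination h' - h)
    · exact h3 (by linear_combination h' - h)
  · rw [not_or] at h
    exact add_pos_of_pos_of_nonneg (mul_pos hp (hA _ _ h.1 h.2))
      (mul_nonneg hs.le (hA.edgeForm_nonneg i _))

theorem eq_zero_of_forall_edgeForm_eq_zero (hA : IsPositive A) (hn : 3 ≤ n) {v : Fin 3 → ℝ}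
    (hv : ∀ i, edgeForm A i v = 0) : v = 0 := by
  have h := hA.sub_div_smul_lift_eq hn 0 v
  simp only [hv, zero_div, zero_smul, add_zero, sub_eq_zero] at h
  have h1 : edgeForm A 1 (lift (A 0)) ≠ 0 := by
    simpa using (hA.edgeForm_sub_one_pos hn 1).ne'
  have hc := hv 1
  rw [h, map_smul, smul_eq_zero_iff_left h1] at hc
  rw [h, hc, zero_smul]

theorem edgeForm_glickMap_pos [NeZero n] (hA : IsPositive A) (hn : 5 ≤ n) {v : Fin 3 → ℝ}
    (hv0 : v ≠ 0) (hv : ∀ i, 0 ≤ edgeForm A i v) (i : ZMod n) :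
    0 < edgeForm A i (glickMap A v) := by
  obtain ⟨j, hj⟩ : ∃ j, edgeForm A j v ≠ 0 := by
    by_contra! h
    exact hv0 (hA.eq_zero_of_forall_edgeForm_eq_zero (by lia) h)
  have hw := hA.edgeForm_edgeVector_pos hn i
  rw [hA.glickMap_apply_eq_sum_edgeVector (by lia), map_sum]
  simp only [map_smul, smul_eq_mul]
  exact Finset.sum_pos' (fun m _ => mul_nonneg (hv m) (hw m).le)
    ⟨j, Finset.mem_univ j, mul_pos ((hv j).lt_of_ne' hj) (hw j)⟩

end IsPositive

end EdgeVector

section Mixing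

variable {n : ℕ} {A : ZMod n → ℝ × ℝ}

theorem glickMap_apply_two [NeZero n] (A : ZMod n → ℝ × ℝ) (v : Fin 3 → ℝ) :
    glickMap A v 2 = ∑ j, (v 2 - diagForm A j v / diagForm A j (lift (A j))) := by
  simp [glickMap_apply_eq_sum, Finset.sum_apply]

namespace IsPositive

theorem diagForm_div_diagForm_self_le_one (hA : IsPositive A) (hn : 3 ≤ n) (i j : ZMod n) :
    diagForm A j (lift (A i)) / diagForm A j (lift (A j)) ≤ 1 := by
  have hj := hA.diagForm_self_pos hn j
  rw [div_le_one hj]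
  by_cases h : i = j
  · rw [h]
  · exact (hA.diagForm_nonpos hn h).trans hj.le

theorem one_sub_diagForm_div_le_glickMap [NeZero n] (hA : IsPositive A) (hn : 3 ≤ n)
    (i j : ZMod n) : 1 - diagForm A j (lift (A i)) / diagForm A j (lift (A j)) ≤
      glickMap A (lift (A i)) 2 := by
  rw [glickMap_apply_two, lift_two]
  exact Finset.single_le_sum
    (f := fun m => 1 - diagForm A m (lift (A i)) / diagForm A m (lift (A m)))
    (fun m _ => sub_nonneg.mpr (hA.diagForm_div_diagForm_self_le_one hn i m)) (Finset.mem_univ j)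

theorem inv_one_sub_fstParam_le_glickMap [NeZero n] (hA : IsPositive A) (hn : 4 ≤ n) (i : ZMod n) :
    (1 - fstParam A i)⁻¹ ≤ glickMap A (lift (A (i - 1))) 2 := by
  have hpos := hA.diagForm_self_pos (by lia) (i + 1)
  rw [fstParam, inv_one_sub_zeroParam hpos.ne'
    ((hA.diagForm_add_one_sub_one_neg hn i).trans hpos).ne]
  exact hA.one_sub_diagForm_div_le_glickMap (by lia) _ _

theorem exists_le_one_sub_fstParam [NeZero n] (hA : IsPositive A) (hn : 5 ≤ n) :
    ∃ δ : ℝ, 0 < δ ∧ ∀ k i, δ ≤ 1 - fstParam (pentagramMap^[k] A) i := by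
  obtain ⟨M, hM⟩ := (Set.finite_range fun i => glickMap A (lift (A i)) 2).bddAbove
  have hiter (k : ℕ) (i : ZMod n) : glickMap A (lift (pentagramMap^[k] A i)) 2 ≤ M :=
    hA.lift_iterate_pentagramMap_mem hn
      (convex_halfSpace_le (LinearMap.proj 2 ∘ₗ glickMap A).isLinear M)
      (fun i => hM (Set.mem_range_self i)) k i
  have hpos (k : ℕ) (i : ZMod n) : 0 < 1 - fstParam (pentagramMap^[k] A) i :=
    sub_pos.mpr ((hA.iterate_pentagramMap hn k).fstParam_mem_Ioo (by lia) i).2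
  have hinv (k : ℕ) (i : ZMod n) : (1 - fstParam (pentagramMap^[k] A) i)⁻¹ ≤ M := by
    refine ((hA.iterate_pentagramMap hn k).inv_one_sub_fstParam_le_glickMap (by lia) i).trans ?_
    rw [hA.glickMap_iterate_pentagramMap hn]
    exact hiter k _
  exact ⟨M⁻¹, inv_pos.mpr ((inv_pos.mpr (hpos 0 0)).trans_le (hinv 0 0)),
    fun k i => inv_le_of_inv_le₀ (hpos k i) (hinv k i)⟩

section

variable {l : Module.Dual ℝ (Fin 3 → ℝ)} {δ : ℝ}

theorem mul_apply_sub_one_le_pentagramMap (hA : IsPositive A) (hn : 4 ≤ n)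
    (hl : ∀ i, 0 ≤ l (lift (A i))) (hδ : ∀ i, δ ≤ 1 - fstParam A i) (i : ZMod n) :
    δ * l (lift (A (i - 1))) ≤ l (lift (pentagramMap A i)) := by
  rw [lift_pentagramMap_eq_fst, AffineMap.lineMap_apply_module, map_add, map_smul, map_smul]
  exact (mul_le_mul_of_nonneg_right (hδ i) (hl _)).trans
    (le_add_of_nonneg_right (mul_nonneg (hA.fstParam_mem_Ioo hn i).1.le (hl _)))

theorem mul_apply_le_pentagramMap (hA : IsPositive A) (hn : 5 ≤ n)
    (hl : ∀ i, 0 ≤ l (lift (A i))) (hδ : ∀ i, δ ≤ 1 - fstParam A i) (i : ZMod n) :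
    δ * l (lift (A i)) ≤ l (lift (pentagramMap A i)) := by
  rw [hA.lift_pentagramMap_eq_snd (by lia), AffineMap.lineMap_apply_module, map_add, map_smul,
    map_smul]
  have hδ' : δ ≤ 1 - sndParam A i := by
    linarith [hδ (i + 1), hA.sndParam_lt_fstParam_add_one hn i]
  exact (mul_le_mul_of_nonneg_right hδ' (hl _)).trans
    (le_add_of_nonneg_right (mul_nonneg (hA.sndParam_mem_Ioo (by lia) i).1.le (hl _)))

theorem pow_mul_apply_sub_le_iterate_pentagramMap (hA : IsPositive A) (hn : 5 ≤ n)
    (hl : ∀ i, 0 ≤ l (lift (A i))) (hδ0 : 0 ≤ δ)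
    (hδ : ∀ k i, δ ≤ 1 - fstParam (pentagramMap^[k] A) i) {m k : ℕ} (hmk : m ≤ k) (i : ZMod n) :
    δ ^ k * l (lift (A (i - m))) ≤ l (lift (pentagramMap^[k] A i)) := by
  induction k generalizing m i with
  | zero => simp [Nat.le_zero.mp hmk]
  | succ k ih =>
    have hAk := hA.iterate_pentagramMap hn k
    have hlk := hA.lift_iterate_pentagramMap_mem hn (convex_halfSpace_ge l.isLinear 0) hl k
    rw [Function.iterate_succ_apply', pow_succ', mul_assoc]
    cases m with
    | zero =>
      exact (mul_le_mul_of_nonneg_left (ih k.zero_le i) hδ0).trans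
        (hAk.mul_apply_le_pentagramMap hn hlk (hδ k) i)
    | succ m =>
      rw [Nat.cast_succ, ← sub_sub, sub_right_comm]
      exact (mul_le_mul_of_nonneg_left (ih (Nat.le_of_succ_le_succ hmk) (i - 1)) hδ0).trans
        (hAk.mul_apply_sub_one_le_pentagramMap (by lia) hlk (hδ k) i)

theorem pow_mul_apply_le_iterate_pentagramMap [NeZero n] (hA : IsPositive A) (hn : 5 ≤ n)
    (hl : ∀ i, 0 ≤ l (lift (A i))) (hδ0 : 0 ≤ δ)
    (hδ : ∀ k i, δ ≤ 1 - fstParam (pentagramMap^[k] A) i) (i j : ZMod n) :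
    δ ^ n * l (lift (A j)) ≤ l (lift (pentagramMap^[n] A i)) := by
  have := hA.pow_mul_apply_sub_le_iterate_pentagramMap hn hl hδ0 hδ (i - j).val_lt.le i
  rwa [ZMod.natCast_zmod_val, sub_sub_cancel] at this

end

end IsPositive

end Mixing

section Limit

variable {n : ℕ} {A : ZMod n → ℝ × ℝ}

theorem continuous_lift : Continuous lift := by
  unfold lift
  fun_prop

namespace IsPositive

variable {p : ℝ × ℝ}

theorem edgeForm_limit_nonneg (hA : IsPositive A) (hn : 5 ≤ n) {j : ZMod n}
    (hp : Tendsto (fun k => pentagramMap^[k] A j) atTop (𝓝 p)) (i : ZMod n) :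
    0 ≤ edgeForm A i (lift p) :=
  ge_of_tendsto'
    (((edgeForm A i).continuous_of_finiteDimensional.comp continuous_lift).tendsto p |>.comp hp)
    fun k => hA.lift_iterate_pentagramMap_mem hn (convex_halfSpace_ge (edgeForm A i).isLinear 0)
      (hA.edgeForm_nonneg i) k j

variable [NeZero n]

theorem exists_tendsto_apply (hA : IsPositive A) (hn : 5 ≤ n) (l : Module.Dual ℝ (Fin 3 → ℝ)) :
    ∃ x, ∀ i, Tendsto (fun k => l (lift (pentagramMap^[k] A i))) atTop (𝓝 x) := by
  obtain ⟨δ, hδ0, hδ⟩ := hA.exists_le_one_sub_fstParam hn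
  have hfin (k : ℕ) := Set.finite_range fun i => l (lift (pentagramMap^[k] A i))
  refine exists_tendsto_of_oscillation_le (antitone_nat_of_succ_le fun k => ?_)
    (monotone_nat_of_le_succ fun k => ?_) (pow_pos hδ0 n) (N := n) fun k i j => ?_
  · refine ciSup_le fun i => ?_
    rw [Function.iterate_succ_apply']
    exact (hA.iterate_pentagramMap hn k).lift_pentagramMap_mem (by lia)
      (convex_halfSpace_le l.isLinear _) (le_ciSup (hfin k).bddAbove) i
  · refine le_ciInf fun i => ?_
    rw [Function.iterate_succ_apply']
    exact (hA.iterate_pentagramMap hn k).lift_pentagramMap_mem (by lia)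
      (convex_halfSpace_ge l.isLinear _) (ciInf_le (hfin k).bddBelow) i
  · set c := ⨅ m, l (lift (pentagramMap^[k] A m))
    let l' : Module.Dual ℝ (Fin 3 → ℝ) := l - c • LinearMap.proj 2
    have hsub (q : ℝ × ℝ) : l' (lift q) = l (lift q) - c := by simp [l']
    have hmix := (hA.iterate_pentagramMap hn k).pow_mul_apply_le_iterate_pentagramMap hn (l := l')
      (fun m => by rw [hsub]; exact sub_nonneg.mpr (ciInf_le (hfin k).bddBelow m)) hδ0.le
      (fun m => by rw [← Function.iterate_add_apply]; exact hδ _) i j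
    rw [← Function.iterate_add_apply, hsub, hsub, add_comm n k] at hmix
    linarith

theorem exists_tendsto (hA : IsPositive A) (hn : 5 ≤ n) :
    ∃ p, ∀ i, Tendsto (fun k => pentagramMap^[k] A i) atTop (𝓝 p) := by
  obtain ⟨x, hx⟩ := hA.exists_tendsto_apply hn (LinearMap.proj 0)
  obtain ⟨y, hy⟩ := hA.exists_tendsto_apply hn (LinearMap.proj 1)
  exact ⟨(x, y), fun i => (hx i).prodMk_nhds (hy i)⟩

theorem exists_glickMap_lift_limit_eq_smul (hA : IsPositive A) (hn : 5 ≤ n)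
    (hp : ∀ i, Tendsto (fun k => pentagramMap^[k] A i) atTop (𝓝 p)) :
    ∃ c : ℝ, glickMap A (lift p) = c • lift p := by
  suffices glickMap A (lift p) ∈ Submodule.span ℝ {lift p} by
    simpa only [Submodule.mem_span_singleton, eq_comm] using this
  refine mem_span_singleton_of_forall_dual (lift_ne_zero p) fun l hl => ?_
  have hcont := l.continuous_of_finiteDimensional.comp continuous_lift
  have hpos : ∀ᶠ k in atTop, ∀ i, 0 < l (lift (pentagramMap^[k] A i)) :=
    eventually_all.mpr fun i => ((hcont.tendsto p).comp (hp i)).eventually_const_lt hl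
  obtain ⟨k, hk⟩ := hpos.exists
  have hAk := hA.iterate_pentagramMap hn k
  have hpk : Tendsto (fun m => pentagramMap^[m] (pentagramMap^[k] A) 0) atTop (𝓝 p) := by
    simpa only [← Function.iterate_add_apply] using (tendsto_add_atTop_iff_nat k).mpr (hp 0)
  rw [← hA.glickMap_iterate_pentagramMap hn k]
  exact hAk.glickMap_apply_nonneg (by lia) (fun i => (hk i).le) (hAk.edgeForm_limit_nonneg hn hpk)

theorem exists_limit (hA : IsPositive A) (hn : 5 ≤ n) :
    ∃ p, (∀ i, Tendsto (fun k => pentagramMap^[k] A i) atTop (𝓝 p)) ∧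
      ∃ c : ℝ, glickMap A (lift p) = c • lift p ∧
        ∀ w, glickMap A w = c • w → ∃ r : ℝ, w = r • lift p := by
  obtain ⟨p, hp⟩ := hA.exists_tendsto hn
  obtain ⟨c, hc⟩ := hA.exists_glickMap_lift_limit_eq_smul hn hp
  exact ⟨p, hp, c, hc, fun w hw => exists_eq_smul_of_strictly_positive
    (fun v => hA.edgeForm_glickMap_pos hn) (lift_ne_zero p) (hA.edgeForm_limit_nonneg hn (hp 0))
    hc hw⟩

end IsPositive

end Limit

section Reflection

variable {n : ℕ}

theorem lift_swap (p : ℝ × ℝ) : lift p.swap = lift p ∘ Equiv.swap 0 1 := by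
  ext k
  fin_cases k <;> simp [lift, Equiv.swap_apply_def]

theorem det3_comp_swap (a b c : Fin 3 → ℝ) :
    det3 (a ∘ Equiv.swap 0 1) (b ∘ Equiv.swap 0 1) (c ∘ Equiv.swap 0 1) = -det3 a b c := by
  simp only [det3_eq, Function.comp_apply, Equiv.swap_apply_left, Equiv.swap_apply_right,
    Equiv.swap_apply_of_ne_of_ne (x := (2 : Fin 3)) (a := 0) (b := 1) (by decide) (by decide)]
  ring

theorem orient_swap (p q r : ℝ × ℝ) : orient p.swap q.swap r.swap = -orient p q r := by
  simp only [orient, lift_swap, det3_comp_swap]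

theorem pentagramMap_swap (A : ZMod n → ℝ × ℝ) :
    pentagramMap (Prod.swap ∘ A) = Prod.swap ∘ pentagramMap A := by
  funext i
  simp only [pentagramMap, lineInter, Function.comp_apply, orient_swap]
  rw [← neg_sub', neg_div_neg_eq]
  ext <;> simp [AffineMap.lineMap_apply]

theorem iterate_pentagramMap_swap (A : ZMod n → ℝ × ℝ) (k : ℕ) :
    pentagramMap^[k] (Prod.swap ∘ A) = Prod.swap ∘ pentagramMap^[k] A :=
  Function.Commute.iterate_left (g := (Prod.swap ∘ ·)) pentagramMap_swap k A

theorem glickMap_swap [NeZero n] (A : ZMod n → ℝ × ℝ) (v : Fin 3 → ℝ) :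
    glickMap (Prod.swap ∘ A) (v ∘ Equiv.swap 0 1) = glickMap A v ∘ Equiv.swap 0 1 := by
  simp only [glickMap_apply_eq_sum, diagForm_apply, Function.comp_apply, lift_swap, det3_comp_swap,
    neg_div_neg_eq]
  ext k
  simp

theorem IsConvexPolygon.isPositive_or_exists_swap {A : ZMod n → ℝ × ℝ}
    (hA : IsConvexPolygon A) : IsPositive A ∨ ∃ B, IsPositive B ∧ Prod.swap ∘ B = A := by
  refine hA.imp id fun h => ⟨Prod.swap ∘ A, fun i j hi hj => ?_, by ext <;> simp⟩
  have := neg_pos.mpr (h i j hi hj)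
  rwa [← orient_swap] at this

theorem IsConvexPolygon.exists_limit [NeZero n] {A : ZMod n → ℝ × ℝ} (hA : IsConvexPolygon A)
    (hn : 5 ≤ n) :
    ∃ p, (∀ i, Tendsto (fun k => pentagramMap^[k] A i) atTop (𝓝 p)) ∧
      ∃ c : ℝ, glickMap A (lift p) = c • lift p ∧
        ∀ w, glickMap A w = c • w → ∃ r : ℝ, w = r • lift p := by
  rcases hA.isPositive_or_exists_swap with h | ⟨B, h, rfl⟩
  · exact h.exists_limit hn
  obtain ⟨p, hp, c, hc, hu⟩ := h.exists_limit hn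
  refine ⟨p.swap, fun i => ?_, c, ?_, fun w hw => ?_⟩
  · simp only [iterate_pentagramMap_swap]
    exact (continuous_swap.tendsto p).comp (hp i)
  · rw [lift_swap, glickMap_swap, hc, Pi.smul_comp]
  · obtain ⟨v, rfl⟩ := (Equiv.swap (0 : Fin 3) 1).injective.surjective_comp_right w
    rw [glickMap_swap, ← Pi.smul_comp] at hw
    obtain ⟨r, rfl⟩ := hu v ((Equiv.swap (0 : Fin 3) 1).surjective.injective_comp_right hw)
    exact ⟨r, by rw [lift_swap, ← Pi.smul_comp]⟩

end Reflection

section CoordField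

variable {n : ℕ} (A : ZMod n → ℝ × ℝ)

theorem lift_mem_coordField (i : ZMod n) (k : Fin 3) : lift (A i) k ∈ coordField A := by
  fin_cases k
  · exact IntermediateField.subset_adjoin _ _ (Or.inl ⟨i, rfl⟩)
  · exact IntermediateField.subset_adjoin _ _ (Or.inr ⟨i, rfl⟩)
  · exact one_mem _

theorem det3_mem {S : Type*} [SetLike S ℝ] [SubringClass S ℝ] {R : S} {a b c : Fin 3 → ℝ}
    (ha : ∀ k, a k ∈ R) (hb : ∀ k, b k ∈ R) (hc : ∀ k, c k ∈ R) : det3 a b c ∈ R := by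
  have minor_mem (i j : Fin 3) : b i * c j - b j * c i ∈ R :=
    sub_mem (mul_mem (hb i) (hc j)) (mul_mem (hb j) (hc i))
  rw [det3_eq]
  exact add_mem (sub_mem (mul_mem (ha 0) (minor_mem 1 2)) (mul_mem (ha 1) (minor_mem 0 2)))
    (mul_mem (ha 2) (minor_mem 0 1))

theorem glickMap_mem_coordField [NeZero n] {v : Fin 3 → ℝ} (hv : ∀ k, v k ∈ coordField A)
    (i : Fin 3) : glickMap A v i ∈ coordField A := by
  have hl := lift_mem_coordField A
  simp only [glickMap_apply_eq_sum, diagForm_apply, Finset.sum_apply, Pi.sub_apply, Pi.smul_apply,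
    smul_eq_mul]
  exact sum_mem fun m _ => sub_mem (hv i) (mul_mem
    (div_mem (det3_mem (hl _) hv (hl _)) (det3_mem (hl _) (hl _) (hl _))) (hl m i))

theorem glickMatrix_mem_coordField [NeZero n] (i j : Fin 3) :
    glickMatrix A i j ∈ coordField A := by
  rw [glickMatrix, LinearMap.toMatrix'_apply]
  refine glickMap_mem_coordField A (fun k => ?_) i
  rw [Pi.single_apply]
  split_ifs
  exacts [one_mem _, zero_mem _]

/-- The matrix of `L_A` over the field generated by the coordinates of the vertices. -/
noncomputable def coordGlickMatrix [NeZero n] : Matrix (Fin 3) (Fin 3) (coordField A) :=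
  Matrix.of fun i j => ⟨glickMatrix A i j, glickMatrix_mem_coordField A i j⟩

theorem map_coordGlickMatrix_mulVec [NeZero n] (v : Fin 3 → ℝ) :
    (coordGlickMatrix A).map (algebraMap (coordField A) ℝ) *ᵥ v = glickMap A v :=
  LinearMap.toMatrix'_mulVec (glickMap A) v

end CoordField

end Pentagram

theorem theorem1 (n : ℕ) [NeZero n] (hn : 5 ≤ n) (A : ZMod n → ℝ × ℝ)
    (hA : Pentagram.IsConvexPolygon A) :
    ∃ X Y : ℝ,
      (∀ i : ZMod n, Filter.Tendsto (fun k : ℕ => (Pentagram.pentagramMap^[k] A) i)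
        Filter.atTop (nhds (X, Y))) ∧
      ∃ lam : ℝ,
        Module.End.HasEigenvector (Matrix.toLin' (Pentagram.glickMatrix A)) lam
          (Pentagram.lift (X, Y)) ∧
        FiniteDimensional (Pentagram.coordField A)
          (IntermediateField.adjoin (Pentagram.coordField A) {lam}) ∧
        Module.finrank (Pentagram.coordField A)
          (IntermediateField.adjoin (Pentagram.coordField A) {lam}) ≤ 3 ∧
        X ∈ IntermediateField.adjoin (Pentagram.coordField A) {lam} ∧
        Y ∈ IntermediateField.adjoin (Pentagram.coordField A) {lam} := by
  obtain ⟨⟨X, Y⟩, hp, c, hc, hu⟩ := hA.exists_limit hn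
  have hne := Pentagram.lift_ne_zero (X, Y)
  set P := (Pentagram.coordGlickMatrix A).charpoly
  have hP : P.Monic := Matrix.charpoly_monic _
  have hdeg : P.natDegree = 3 := Matrix.charpoly_natDegree_eq_dim _
  simp only [← Pentagram.map_coordGlickMatrix_mulVec] at hc hu
  have hroot := Pentagram.exists_map_mulVec_eq_smul_iff_aeval_charpoly.mp ⟨_, hne, hc⟩
  have hmem := Pentagram.mem_adjoin_of_forall_eigenvector (Pentagram.lift_two (X, Y)) hc hu
  exact ⟨X, Y, hp, c, Module.End.hasEigenvector_iff.mpr ⟨Module.End.mem_eigenspace_iff.mpr hc, hne⟩,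
    IntermediateField.adjoin.finiteDimensional ⟨P, hP, hroot⟩,
    (Pentagram.finrank_adjoin_le_natDegree hP.ne_zero hroot).trans_eq hdeg, hmem 0, hmem 1⟩
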